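/- For points $p,q\in\mathbb R^d$ let $\mathrm{box}(p,q)=\{x\in\mathbb R^d : \min(p_i,q_i)\le x_i\le \max(p_i,q_i)\text{ for all } i\}$ be the smallest closed axis-parallel box containing $p$ and $q$. The $d$-dimensional box-cover number $g(d)$ is the smallest integer $N$ such that every finite set $S\subset\mathbb R^d$ has a subset $P\subseteq S$ with $|P|\le N$ such that every $s\in S$ lies in $\mathrm{box}(p,q)$ for some (not necessarily distinct) $p,q\in P$. Theorem. The number $g(d)$ exists and satisfies $g(d)=O\bigl(2^{2^{d-1}}\,d\log d\bigr)$. That is, there is an absolute constant $C>0$ such that for every $d\ge 2$ the number $g(d)$ is finite and $g(d)\le C\,2^{2^{d-1}}\,d\log d$. In particular, for every $d\ge 2$, from any finite $S\subset\mathbb R^d$ one can pick at most $C\,2^{2^{d-1}}\,d\log d$ points of $S$ such that every point of $S$ lies in the box spanned by two (possibly equal) of the chosen points. -/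

import Mathlib

namespace BoxCover

/-- The smallest closed axis-parallel box in `ℝ^d` that contains `p` and `q`. -/
def box {d : ℕ} (p q : Fin d → ℝ) : Set (Fin d → ℝ) :=
  {x | ∀ i, min (p i) (q i) ≤ x i ∧ x i ≤ max (p i) (q i)}

/-- Every point of `S` lies in the box spanned by two (possibly equal) points of `P`. -/
def Covers {d : ℕ} (P S : Finset (Fin d → ℝ)) : Prop :=
  ∀ s ∈ S, ∃ p ∈ P, ∃ q ∈ P, s ∈ box p q

/-- From every finite `S ⊆ ℝ^d` one can select at most `N` points whose boxes cover `S`. -/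
def Suffices (d N : ℕ) : Prop :=
  ∀ S : Finset (Fin d → ℝ), ∃ P ⊆ S, P.card ≤ N ∧ Covers P S

/-- The `d`-dimensional box-cover number: the smallest `N` with `Suffices d N`. The infimum is
taken in `ℕ`, so it is meaningful only when such an `N` exists, i.e. when it is attained. -/
noncomputable def boxCoverNumber (d : ℕ) : ℕ :=
  sInf {N : ℕ | Suffices d N}

end BoxCover

namespace BoxCover

open Finset

/-! Choose one closed orthant from each of the `2^(d-1)` antipodal pairs and let `U` be their union.
The relation `y - x ∈ U` is total, so minimax for a skew game gives a weighting under which every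
point is related to at least half the mass. Only coordinate comparisons matter, so points can be
grouped into `(8d+1)^(2d)` cells with a common quarter of the mass per cell, and greedy hitting
yields `O(d log d)` dominating points (`exists_dominating`). Let `Q` be the union of these sets over
all `2^(2^(d-1))` choices. If `s` were uncovered, each antipodal pair at `s` would contain an
orthant missing `Q`; domination for that choice is a contradiction (`suffices_of_pow_lt`). -/

/-- A symmetric game has an optimal strategy of nonnegative value. -/
theorem exists_mem_stdSimplex_skew_nonneg {ι : Type*} [Fintype ι] [Nonempty ι]
    (A : ι → ι → ℝ) (hA : ∀ i j, A i j = -A j i) :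
    ∃ w ∈ stdSimplex ℝ ι, ∀ i, 0 ≤ ∑ j, A i j * w j := by
  classical
  let L : (ι → ℝ) →ₗ[ℝ] (ι → ℝ) := Matrix.mulVecLin (Matrix.of A)
  have hL : ∀ w i, L w i = ∑ j, A i j * w j := fun w i => rfl
  by_contra! h
  have hdisj : Disjoint (L '' stdSimplex ℝ ι) {y : ι → ℝ | ∀ i, 0 ≤ y i} := by
    rw [Set.disjoint_left]
    rintro _ ⟨w, hw, rfl⟩ hpos
    obtain ⟨i, hi⟩ := h w hw
    exact absurd (hpos i) (by rw [hL]; exact not_le.mpr hi)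
  have hcont : Continuous L := L.continuous_of_finiteDimensional
  have hclosed : IsClosed {y : ι → ℝ | ∀ i, 0 ≤ y i} := by
    simp only [Set.ofPred_forall]
    exact isClosed_iInter fun i => isClosed_le continuous_const (continuous_apply i)
  have hconv : Convex ℝ {y : ι → ℝ | ∀ i, 0 ≤ y i} := by
    intro x hx y hy a b ha hb _ i
    exact add_nonneg (mul_nonneg ha (hx i)) (mul_nonneg hb (hy i))
  -- The separating functional, once normalized, is itself a strategy; skewness gives it payoff 0
  -- against itself, contradicting separation.
  obtain ⟨f, u, v, hu, huv, hv⟩ := geometric_hahn_banach_compact_closed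
    ((convex_stdSimplex ℝ ι).linear_image L)
    ((isCompact_stdSimplex ℝ ι).image hcont) hconv hclosed hdisj
  have hv0 : v < 0 := by simpa using hv 0 (fun i => le_rfl)
  let y : ι → ℝ := fun i => f (Pi.single i 1)
  have hf : ∀ z : ι → ℝ, f z = ∑ i, z i * y i := by
    intro z
    conv_lhs => rw [pi_eq_sum_univ' z]
    rw [map_sum]
    refine sum_congr rfl fun i _ => ?_
    rw [map_smul, smul_eq_mul]
  have hy : ∀ i, 0 ≤ y i := by
    intro i
    by_contra! hi
    have := hv (Pi.single i (v / y i)) (fun j => by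
      by_cases hj : j = i
      · subst hj
        simpa using div_nonneg_of_nonpos hv0.le hi.le
      · simp [hj])
    rw [hf, sum_eq_single i (by intro j _ hj; simp [hj]) (by simp)] at this
    simp [div_mul_cancel₀ _ hi.ne] at this
  have hskew : ∑ i, (∑ j, A i j * y j) * y i = 0 := by
    have hswap : ∑ i, (∑ j, A i j * y j) * y i = -∑ i, (∑ j, A i j * y j) * y i := by
      simp only [sum_mul]
      conv_lhs => rw [sum_comm]
      rw [← sum_neg_distrib]
      refine sum_congr rfl fun i _ => ?_
      rw [← sum_neg_distrib]
      refine sum_congr rfl fun j _ => ?_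
      rw [hA j i]
      ring
    linarith
  have hpos : 0 < ∑ i, y i := by
    refine lt_of_le_of_ne (sum_nonneg fun i _ => hy i) fun h0 => ?_
    have hy0 := (sum_eq_zero_iff_of_nonneg fun i _ => hy i).mp h0.symm
    obtain ⟨i⟩ := ‹Nonempty ι›
    have := hu _ ⟨_, single_mem_stdSimplex ℝ i, rfl⟩
    rw [hf, sum_eq_zero fun j hj => by rw [hy0 j hj, mul_zero]] at this
    linarith
  have hw : (∑ i, y i)⁻¹ • y ∈ stdSimplex ℝ ι := by
    refine ⟨fun i => mul_nonneg (inv_nonneg.mpr hpos.le) (hy i), ?_⟩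
    simp only [Pi.smul_apply, smul_eq_mul, ← mul_sum]
    exact inv_mul_cancel₀ hpos.ne'
  have := hu _ ⟨_, hw, rfl⟩
  rw [map_smul, map_smul, hf] at this
  simp only [hL] at this
  rw [hskew, smul_zero] at this
  linarith

/-- A total relation carries a probability weight for which every point is related to at least
half of the total mass. -/
theorem exists_weight_of_total {V : Type*} [Fintype V] [Nonempty V] (r : V → V → Prop)
    [∀ v x, Decidable (r v x)] (hr : ∀ x y, r x y ∨ r y x) :
    ∃ w ∈ stdSimplex ℝ V, ∀ v, 1 / 2 ≤ ∑ x with r v x, w x := by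
  obtain ⟨w, hw, h⟩ := exists_mem_stdSimplex_skew_nonneg
    (fun x y : V => (if r x y then (1 : ℝ) else 0) - if r y x then 1 else 0)
    (fun i j => by ring)
  refine ⟨w, hw, fun v => ?_⟩
  -- Totality forces the two indicators to sum to at least 1.
  have h1 : ∑ x, ((if r v x then (1 : ℝ) else 0) - if r x v then 1 else 0) * w x ≤
      ∑ x, (2 * (if r v x then w x else 0) - w x) := by
    refine sum_le_sum fun x _ => ?_
    have := hw.1 x
    rcases hr v x with hx | hx <;> split_ifs <;> simp_all <;> linarith
  have h2 := (h v).trans h1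
  rw [sum_sub_distrib, hw.2, ← mul_sum, ← sum_filter] at h2
  linarith

/-- Greedy hitting sets: if every member of a family carries at least a quarter of the mass, then
few points hit all of them. -/
theorem exists_greedy_hitting {V ι : Type*} [Fintype V] [Fintype ι] [DecidableEq V]
    {w : V → ℝ} (hw : w ∈ stdSimplex ℝ V) (F : ι → Finset V)
    (hF : ∀ i, 1 / 4 ≤ ∑ x ∈ F i, w x) (m : ℕ) :
    ∃ P : Finset V, P.card ≤ m ∧
      (#{i | Disjoint P (F i)} : ℝ) ≤ (3 / 4) ^ m * Fintype.card ι := by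
  induction m with
  | zero => exact ⟨∅, by simp, by simp⟩
  | succ m ih =>
    obtain ⟨P, hP, hc⟩ := ih
    set U : Finset ι := {i | Disjoint P (F i)} with hU
    -- Averaging over `w`: some point hits at least a quarter of the unhit sets.
    have hex : ∃ x, (#U : ℝ) / 4 ≤ #{i ∈ U | x ∈ F i} := by
      by_contra! hlt
      have h1 : (#U : ℝ) / 4 ≤ ∑ x, w x * #{i ∈ U | x ∈ F i} := by
        calc (#U : ℝ) / 4 = ∑ _i ∈ U, (1 / 4 : ℝ) := by
              rw [sum_const, nsmul_eq_mul]; ring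
          _ ≤ ∑ i ∈ U, ∑ x ∈ F i, w x := sum_le_sum fun i _ => hF i
          _ = ∑ i ∈ U, ∑ x, if x ∈ F i then w x else 0 := by simp
          _ = ∑ x, w x * #{i ∈ U | x ∈ F i} := by
              rw [sum_comm]
              refine sum_congr rfl fun x _ => ?_
              rw [← sum_filter, sum_const, nsmul_eq_mul, mul_comm]
      have h2 : ∑ x, w x * #{i ∈ U | x ∈ F i} < ∑ x, w x * ((#U : ℝ) / 4) := by
        obtain ⟨x, _, hx⟩ : ∃ x ∈ (univ : Finset V), 0 < w x := by
          apply exists_lt_of_sum_lt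
          simp [hw.2]
        exact sum_lt_sum (fun x _ => mul_le_mul_of_nonneg_left (hlt x).le (hw.1 x))
          ⟨x, mem_univ x, mul_lt_mul_of_pos_left (hlt x) hx⟩
      rw [← sum_mul, hw.2, one_mul] at h2
      linarith
    obtain ⟨x, hx⟩ := hex
    refine ⟨insert x P, (card_insert_le _ _).trans (by omega), ?_⟩
    have hsub : ({i | Disjoint (insert x P) (F i)} : Finset ι) = {i ∈ U | ¬ x ∈ F i} := by
      ext i
      simp [hU, disjoint_insert_left, and_comm]
    have hsplit : (#{i ∈ U | x ∈ F i} : ℝ) + #{i ∈ U | ¬ x ∈ F i} = #U := by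
      exact_mod_cast card_filter_add_card_filter_not (s := U) (fun i => x ∈ F i)
    rw [hsub, pow_succ]
    nlinarith

/-- A weighted finite set with a real coordinate splits into few classes each of which is constant
or spans an interval of small mass. -/
theorem exists_coordinate_cells {V : Type*} [Fintype V] {w : V → ℝ} (hw : w ∈ stdSimplex ℝ V)
    (f : V → ℝ) {k : ℕ} (hk : 0 < k) :
    ∃ c : V → Fin (k + 1) × Fin (k + 1), ∀ a b, c a = c b → f a < f b →
      ∑ x with f a ≤ f x ∧ f x ≤ f b, w x ≤ 2 / k := by
  let G : V → ℝ := fun a => ∑ x with f x < f a, w x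
  let H : V → ℝ := fun a => ∑ x with f x ≤ f a, w x
  have hk' : (0 : ℝ) < k := by exact_mod_cast hk
  have hle : ∀ s : Finset V, ⌊k * ∑ x ∈ s, w x⌋₊ < k + 1 := by
    intro s
    have : ∑ x ∈ s, w x ≤ 1 :=
      hw.2 ▸ sum_le_sum_of_subset_of_nonneg (subset_univ s) fun x _ _ => hw.1 x
    refine Nat.lt_succ_of_le (Nat.floor_le_of_le ?_)
    nlinarith
  have hnonneg : ∀ s : Finset V, 0 ≤ k * ∑ x ∈ s, w x := fun s =>
    mul_nonneg hk'.le (sum_nonneg fun x _ => hw.1 x)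
  have hclose : ∀ s t : Finset V, ⌊k * ∑ x ∈ s, w x⌋₊ = ⌊k * ∑ x ∈ t, w x⌋₊ →
      k * ∑ x ∈ t, w x ≤ k * ∑ x ∈ s, w x + 1 := by
    intro s t h
    have h1 := Nat.floor_le (hnonneg s)
    have h2 := Nat.lt_floor_add_one (k * ∑ x ∈ t, w x)
    rw [h] at h1
    linarith
  -- Rounding both the strict and the weak distribution function isolates atoms: for `f a < f b` in
  -- one class, `H b ≤ H a + 1/k ≤ G b + 1/k ≤ G a + 2/k`.
  refine ⟨fun a => (⟨⌊k * G a⌋₊, hle _⟩, ⟨⌊k * H a⌋₊, hle _⟩), fun a b hab hlt => ?_⟩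
  simp only [Prod.mk.injEq, Fin.mk.injEq] at hab
  have hG : k * G b ≤ k * G a + 1 := hclose _ _ hab.1
  have hH : k * H b ≤ k * H a + 1 := hclose _ _ hab.2
  have hHG : H a ≤ G b := by
    refine sum_le_sum_of_subset_of_nonneg (fun x hx => ?_) fun x _ _ => hw.1 x
    simp only [mem_filter, mem_univ, true_and] at hx ⊢
    exact hx.trans_lt hlt
  have hint : G a + ∑ x with f a ≤ f x ∧ f x ≤ f b, w x = H b := by
    simp only [G, H, sum_filter, ← sum_add_distrib]
    refine sum_congr rfl fun x _ => ?_
    by_cases h1 : f x < f a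
    · simp [h1, not_le.mpr h1, (h1.trans hlt).le]
    · simp [h1, not_lt.mp h1]
  rw [le_div_iff₀ hk']
  nlinarith

theorem sum_biUnion_le_sum_of_nonneg {V ι : Type*} [DecidableEq V] {w : V → ℝ}
    (hw : ∀ x, 0 ≤ w x) (s : Finset ι) (B : ι → Finset V) :
    ∑ x ∈ s.biUnion B, w x ≤ ∑ i ∈ s, ∑ x ∈ B i, w x := by
  classical
  induction s using Finset.induction_on with
  | empty => simp
  | insert i s hi ih =>
    rw [biUnion_insert, sum_insert hi]
    have h1 := sum_union_inter (s₁ := B i) (s₂ := s.biUnion B) (f := w)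
    have h2 : 0 ≤ ∑ x ∈ B i ∩ s.biUnion B, w x := sum_nonneg fun x _ => hw x
    linarith

/-- If a total relation on a finite point set in `ℝ^d` depends only on coordinatewise comparisons,
then few points dominate. -/
theorem exists_dominating {V : Type*} [Fintype V] [DecidableEq V] {d : ℕ} (hd : 0 < d)
    (p : V → Fin d → ℝ) (r : V → V → Prop) (hr : ∀ x y, r x y ∨ r y x)
    (hcomp : ∀ v v' x, (∀ i, (p v i ≤ p x i ↔ p v' i ≤ p x i) ∧
      (p x i ≤ p v i ↔ p x i ≤ p v' i)) → r v x → r v' x)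
    {m : ℕ} (hm : (3 / 4 : ℝ) ^ m * ((8 * d + 1 : ℕ) : ℝ) ^ (2 * d) < 1) :
    ∃ P : Finset V, P.card ≤ m ∧ ∀ v, ∃ x ∈ P, r v x := by
  classical
  rcases isEmpty_or_nonempty V with hV | hV
  · exact ⟨∅, by simp, fun v => hV.elim v⟩
  obtain ⟨w, hw, hhalf⟩ := exists_weight_of_total r hr
  have hk : 0 < 8 * d := by omega
  choose c hc using fun i : Fin d => exists_coordinate_cells hw (fun v => p v i) hk
  let cell : V → Fin d → Fin (8 * d + 1) × Fin (8 * d + 1) := fun v i => c i v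
  let core : V → Finset V := fun v => {x | ∀ v', cell v' = cell v → r v' x}
  have hbad : ∀ v i, ∃ B : Finset V, ∑ x ∈ B, w x ≤ 2 / (8 * d : ℕ) ∧
      ∀ a b x, cell a = cell v → cell b = cell v → p a i < p b i →
        p a i ≤ p x i → p x i ≤ p b i → x ∈ B := by
    intro v i
    have hne : ({a | cell a = cell v} : Finset V).Nonempty := ⟨v, by simp⟩
    obtain ⟨a₀, ha₀, hmin⟩ := exists_min_image _ (fun a => p a i) hne
    obtain ⟨b₀, hb₀, hmax⟩ := exists_max_image _ (fun a => p a i) hne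
    simp only [mem_filter, mem_univ, true_and] at ha₀ hb₀ hmin hmax
    by_cases hlt : p a₀ i < p b₀ i
    · refine ⟨_, hc i a₀ b₀ (congrFun (ha₀.trans hb₀.symm) i) hlt, ?_⟩
      intro a b x ha hb _ hax hxb
      simp only [mem_filter, mem_univ, true_and]
      exact ⟨(hmin a ha).trans hax, hxb.trans (hmax b hb)⟩
    · refine ⟨∅, by rw [sum_empty]; positivity, fun a b x ha hb hab _ _ => ?_⟩
      exact absurd (((hmin a ha).trans_lt hab).trans_le (hmax b hb)) hlt
  have hcore : ∀ v, 1 / 4 ≤ ∑ x ∈ core v, w x := by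
    intro v
    choose B hB hmem using hbad v
    -- Outside the `d` intervals spanned by the cell, `x` compares alike with all its members. Each
    -- interval has mass at most `2/(8d)`, so a quarter survives.
    have hsub : ({x | r v x} : Finset V) ⊆ core v ∪ univ.biUnion B := by
      intro x hx
      simp only [mem_filter, mem_univ, true_and] at hx
      by_contra hnot
      simp only [mem_union, mem_biUnion, mem_univ, true_and, not_or, not_exists] at hnot
      apply hnot.1
      simp only [core, mem_filter, mem_univ, true_and]
      intro v' hv'
      refine hcomp v v' x (fun i => ?_) hx
      have h1 := fun hlt h2 h3 => hnot.2 i (hmem i v v' x rfl hv' hlt h2 h3)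
      have h2 := fun hlt h2 h3 => hnot.2 i (hmem i v' v x hv' rfl hlt h2 h3)
      rcases lt_trichotomy (p v i) (p v' i) with h | h | h
      · constructor <;> constructor <;> intro h' <;> by_contra! h'' <;>
          exact h1 h (by linarith) (by linarith)
      · simp [h]
      · constructor <;> constructor <;> intro h' <;> by_contra! h'' <;>
          exact h2 h (by linarith) (by linarith)
    have hB' : ∑ x ∈ univ.biUnion B, w x ≤ 1 / 4 := by
      calc ∑ x ∈ univ.biUnion B, w x ≤ ∑ i, ∑ x ∈ B i, w x :=
            sum_biUnion_le_sum_of_nonneg hw.1 univ B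
        _ ≤ ∑ _i : Fin d, (2 / (8 * d : ℕ) : ℝ) := sum_le_sum fun i _ => hB i
        _ = 1 / 4 := by
            have : (d : ℝ) ≠ 0 := by exact_mod_cast hd.ne'
            simp only [sum_const, card_univ, Fintype.card_fin, nsmul_eq_mul]
            push_cast
            field_simp
            norm_num
    have h1 := sum_le_sum_of_subset_of_nonneg (f := w) hsub fun x _ _ => hw.1 x
    have h2 := sum_union_inter (s₁ := core v) (s₂ := univ.biUnion B) (f := w)
    have h3 : 0 ≤ ∑ x ∈ core v ∩ univ.biUnion B, w x := sum_nonneg fun x _ => hw.1 x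
    linarith [hhalf v]
  obtain ⟨P, hP, hmiss⟩ := exists_greedy_hitting hw
    (fun z : Set.range cell => core z.2.choose) (fun z => hcore _) m
  refine ⟨P, hP, fun v => ?_⟩
  have hcard : (Fintype.card (Set.range cell) : ℝ) ≤ ((8 * d + 1 : ℕ) : ℝ) ^ (2 * d) := by
    have := Fintype.card_subtype_le (fun z => z ∈ Set.range cell)
    have h2 : Fintype.card (Fin d → Fin (8 * d + 1) × Fin (8 * d + 1)) =
        (8 * d + 1) ^ (2 * d) := by
      simp [← pow_two, pow_mul]
    rw [h2] at this
    exact_mod_cast this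
  have hzero : (#{z : Set.range cell | Disjoint P (core z.2.choose)} : ℝ) < 1 :=
    (hmiss.trans (mul_le_mul_of_nonneg_left hcard (by positivity))).trans_lt hm
  have hempty : #{z : Set.range cell | Disjoint P (core z.2.choose)} = 0 := by
    exact Nat.lt_one_iff.mp (by exact_mod_cast hzero)
  rw [card_eq_zero, filter_eq_empty_iff] at hempty
  let z : Set.range cell := ⟨cell v, v, rfl⟩
  obtain ⟨x, hxP, hx⟩ := not_disjoint_iff.mp (hempty (mem_univ z))
  simp only [core, mem_filter, mem_univ, true_and] at hx
  exact ⟨x, hxP, hx v z.2.choose_spec.symm⟩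

/-! ### Orthant choices and box covers -/

/-- The closed orthant order on `ℝ^(n+1)` with positive first sign and other signs `τ`. -/
def OrthantLE {n : ℕ} (τ : Fin n → Bool) (x y : Fin (n + 1) → ℝ) : Prop :=
  x 0 ≤ y 0 ∧ ∀ i, if τ i then x i.succ ≤ y i.succ else y i.succ ≤ x i.succ

theorem mem_box_of_orthantLE {n : ℕ} {τ : Fin n → Bool} {p s q : Fin (n + 1) → ℝ}
    (hps : OrthantLE τ p s) (hsq : OrthantLE τ s q) : s ∈ box p q := by
  intro i
  refine Fin.cases ?_ (fun j => ?_) i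
  · exact ⟨min_le_of_left_le hps.1, le_max_of_le_right hsq.1⟩
  · have h1 := hps.2 j
    have h2 := hsq.2 j
    cases hτ : τ j <;> simp only [hτ, if_true, Bool.false_eq_true, if_false] at h1 h2
    · exact ⟨min_le_of_right_le h2, le_max_of_le_left h1⟩
    · exact ⟨min_le_of_left_le h1, le_max_of_le_right h2⟩

theorem exists_orthantLE {n : ℕ} {x y : Fin (n + 1) → ℝ} (h : x 0 ≤ y 0) :
    ∃ τ, OrthantLE τ x y := by
  refine ⟨fun i => decide (x i.succ ≤ y i.succ), h, fun i => ?_⟩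
  by_cases hi : x i.succ ≤ y i.succ
  · simp [hi]
  · simpa [hi] using (not_le.mp hi).le

/-- The relation `y - x ∈ U`, where `U` is the union of closed orthants, one from each antipodal
pair, selected by `σ`. -/
def OrthantRel {n : ℕ} (σ : (Fin n → Bool) → Bool) (x y : Fin (n + 1) → ℝ) : Prop :=
  ∃ τ, if σ τ then OrthantLE τ x y else OrthantLE τ y x

/-- The difference of two points lies in some closed orthant, and `σ` selects that orthant or its
antipode. -/
theorem orthantRel_total {n : ℕ} (σ : (Fin n → Bool) → Bool) (x y : Fin (n + 1) → ℝ) :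
    OrthantRel σ x y ∨ OrthantRel σ y x := by
  rcases le_total (x 0) (y 0) with h | h
  all_goals
    obtain ⟨τ, hτ⟩ := exists_orthantLE h
    cases hσ : σ τ
  · exact Or.inr ⟨τ, by simpa [hσ] using hτ⟩
  · exact Or.inl ⟨τ, by simpa [hσ] using hτ⟩
  · exact Or.inl ⟨τ, by simpa [hσ] using hτ⟩
  · exact Or.inr ⟨τ, by simpa [hσ] using hτ⟩

theorem OrthantRel.congr_left {n : ℕ} {σ : (Fin n → Bool) → Bool} {v v' x : Fin (n + 1) → ℝ}
    (h : ∀ i, (v i ≤ x i ↔ v' i ≤ x i) ∧ (x i ≤ v i ↔ x i ≤ v' i))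
    (hv : OrthantRel σ v x) : OrthantRel σ v' x := by
  simpa only [OrthantRel, OrthantLE, (h _).1, (h _).2] using hv

theorem suffices_of_pow_lt {n m : ℕ}
    (hm : (3 / 4 : ℝ) ^ m * ((8 * (n + 1) + 1 : ℕ) : ℝ) ^ (2 * (n + 1)) < 1) :
    Suffices (n + 1) (2 ^ 2 ^ n * m) := by
  classical
  intro S
  choose P hP hdom using fun σ : (Fin n → Bool) → Bool =>
    exists_dominating (V := S) n.succ_pos Subtype.val (fun x y => OrthantRel σ x.1 y.1)
      (fun x y => orthantRel_total σ x.1 y.1) (fun v v' x h => OrthantRel.congr_left h) hm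
  refine ⟨(univ.biUnion P).map (Function.Embedding.subtype _), ?_, ?_, ?_⟩
  · intro x hx
    obtain ⟨y, _, rfl⟩ := mem_map.mp hx
    exact y.2
  · rw [card_map]
    refine (card_biUnion_le_card_mul _ _ m fun σ _ => hP σ).trans_eq ?_
    simp
  · intro s hs
    set Q := (univ.biUnion P).map (Function.Embedding.subtype _) with hQ
    by_contra hcov
    push Not at hcov
    -- Select the `τ`-orthant at `s` if it misses `Q`, otherwise its antipode; a point of `Q` in
    -- that antipode would complete a box around `s`.
    let σ : (Fin n → Bool) → Bool := fun τ => decide (∀ q ∈ Q, ¬ OrthantLE τ s q)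
    obtain ⟨x, hx, τ, hτ⟩ := hdom σ ⟨s, hs⟩
    have hxQ : x.1 ∈ Q := mem_map_of_mem _ (mem_biUnion.mpr ⟨σ, mem_univ σ, hx⟩)
    by_cases hσ : ∀ q ∈ Q, ¬ OrthantLE τ s q
    · rw [if_pos (by simpa [σ] using hσ)] at hτ
      exact hσ _ hxQ hτ
    · rw [if_neg (by simpa [σ] using hσ)] at hτ
      push Not at hσ
      obtain ⟨q, hq, hsq⟩ := hσ
      exact hcov _ hxQ q hq (mem_box_of_orthantLE hτ hsq)

theorem exists_net_size {d : ℕ} (hd : 2 ≤ d) :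
    ∃ m : ℕ, (3 / 4 : ℝ) ^ m * ((8 * d + 1 : ℕ) : ℝ) ^ (2 * d) < 1 ∧
      (m : ℝ) ≤ 41 * (d * Real.log d) := by
  have hd' : (2 : ℝ) ≤ d := by exact_mod_cast hd
  have hlog2 : Real.log 2 ≤ Real.log d := Real.log_le_log (by norm_num) hd'
  have hlog : 1 / 2 ≤ Real.log d := by linarith [Real.log_two_gt_d9]
  have hlog8 : Real.log ((8 * d + 1 : ℕ) : ℝ) ≤ 5 * Real.log d := by
    rw [show (5 : ℝ) * Real.log d = Real.log ((d : ℝ) ^ 5) by rw [Real.log_pow]; norm_num]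
    refine Real.log_le_log (by positivity) ?_
    push_cast
    have : (2 : ℝ) ^ 4 ≤ (d : ℝ) ^ 4 := by gcongr
    nlinarith
  have hlog34 : Real.log (3 / 4) ≤ -(1 / 4) := by
    linarith [Real.log_le_sub_one_of_pos (show (0 : ℝ) < 3 / 4 by norm_num)]
  have hnonneg : 0 ≤ 40 * (d * Real.log d) := by positivity
  -- The cell count has logarithm at most `10 d log d`, and each greedy step gains at least `1/4`.
  -- The extra 1 is absorbed since `d log d ≥ 1`.
  refine ⟨⌊40 * (d * Real.log d)⌋₊ + 1, ?_, ?_⟩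
  · have hfl := Nat.lt_floor_add_one (40 * (d * Real.log d))
    set m := ⌊40 * (d * Real.log d)⌋₊ + 1 with hm
    have hm' : 40 * (d * Real.log d) < m := by rw [hm]; exact_mod_cast hfl
    rw [← Real.log_neg_iff (by positivity), Real.log_mul (by positivity) (by positivity),
      Real.log_pow, Real.log_pow]
    have h1 : (m : ℝ) * Real.log (3 / 4) ≤ m * -(1 / 4) := by gcongr
    have h2 : ((2 * d : ℕ) : ℝ) * Real.log ((8 * d + 1 : ℕ) : ℝ) ≤
        (2 * d : ℕ) * (5 * Real.log d) := by gcongr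
    push_cast at h1 h2 ⊢
    linarith
  · have hfl := Nat.floor_le hnonneg
    push_cast
    nlinarith

end BoxCover

theorem mainTheorem1 :
    ∃ C : ℝ, 0 < C ∧ ∀ d : ℕ, 2 ≤ d →
      BoxCover.Suffices d (BoxCover.boxCoverNumber d) ∧
      (BoxCover.boxCoverNumber d : ℝ) ≤
        C * ((2 : ℝ) ^ (2 ^ (d - 1) : ℕ) * (d : ℝ) * Real.log (d : ℝ)) := by
  refine ⟨41, by norm_num, fun d hd => ?_⟩
  obtain ⟨m, hm, hmle⟩ := BoxCover.exists_net_size hd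
  obtain ⟨n, rfl⟩ : ∃ n, d = n + 1 := ⟨d - 1, by omega⟩
  have hS := BoxCover.suffices_of_pow_lt hm
  -- Nonemptiness rules out the default value `sInf ∅ = 0`.
  have hmem : BoxCover.boxCoverNumber (n + 1) ∈ {N | BoxCover.Suffices (n + 1) N} :=
    Nat.sInf_mem ⟨_, hS⟩
  refine ⟨hmem, ?_⟩
  have hle : (BoxCover.boxCoverNumber (n + 1) : ℝ) ≤ ((2 ^ 2 ^ n * m : ℕ) : ℝ) := by
    exact_mod_cast Nat.sInf_le hS
  refine hle.trans ?_
  rw [Nat.add_sub_cancel]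
  push_cast at hmle ⊢
  calc (2 : ℝ) ^ 2 ^ n * m ≤ 2 ^ 2 ^ n * (41 * ((n + 1) * Real.log (n + 1))) := by gcongr
    _ = _ := by ring
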